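/- **Theorem 4.4 (Lower bound).** Let $d\in\mathbb N$, $\alpha\in(0,d]$ and $L>0$, and let $\mathcal X=[0,1]^d$ with the Euclidean metric. There are constants $C,c,\varepsilon_0>0$, depending only on $d,\alpha,L$, such that the following holds for every $\sigma>0$ and every $\varepsilon\in(0,\varepsilon_0]$. Suppose that querying $x\in\mathcal X$ returns $f(x)+\xi$, where the noise variables $\xi$ are independent with law $N(0,\sigma^2)$ (which is $\sigma$-sub-Gaussian, i.e. $\mathbb E\,e^{\lambda\xi}\le e^{\lambda^2\sigma^2/2}$ for all $\lambda\in\mathbb R$). Let $T\ge 0$ be an integer and consider any adaptive, possibly randomized algorithm that takes $T$ samples (each query point may depend on all earlier queries and observations) and then outputs $\hat x_T\in\mathcal X$. Then there is a function $f:\mathcal X\to[0,1]$ with $|f(x)-f(y)|\le L\|x-y\|$ for all $x,y\in\mathcal X$, satisfying, with $f^*=\max_{\mathcal X} f$, the margin condition $$\mathrm{Vol}\bigl(\{x\in\mathcal X: f(x)\ge f^*-r\}\bigr)\le C\,r^{\,d-\alpha}\qquad\text{for all } r>0,$$ such that if the algorithm run on $f$ is $\varepsilon$-optimal with probability at least $2/3$,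 that is, $\mathbb P\bigl(f^*-f(\hat x_T)\le\varepsilon\bigr)\ge 2/3$, then $$T\ \ge\ c\,\sigma^2\,\varepsilon^{-(2+\alpha)}.$$ In particular $T=\Omega(\varepsilon^{-(2+\alpha)})$ samples are necessary. -/

import Mathlib

open MeasureTheory ProbabilityTheory
open scoped ENNReal NNReal

namespace LipschitzOpt

/-- The domain `[0,1]^d` inside Euclidean space; its subtype carries the Euclidean metric. -/
def cube (d : ℕ) : Set (EuclideanSpace ℝ (Fin d)) :=
  {x | ∀ i, x i ∈ Set.Icc (0 : ℝ) 1}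

/-- A transcript of `t` rounds: the queried points together with the observed values. -/
abbrev History (d t : ℕ) : Type := Fin t → cube d × ℝ

/-- The global maximum value `f^*` of `f` on `[0,1]^d`. -/
noncomputable def maxValue {d : ℕ} (f : cube d → ℝ) : ℝ := ⨆ x, f x

/-- The simple regret `f^* - f(x)` of the recommendation `x`. -/
noncomputable def regret {d : ℕ} (f : cube d → ℝ) (x : cube d) : ℝ := maxValue f - f x

/-- Objectives of the problem: functions `[0,1]^d → [0,1]` that are `L`-Lipschitz for the
Euclidean distance. -/
def IsLipschitzObjective {d : ℕ} (L : ℝ) (f : cube d → ℝ) : Prop :=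
  (∀ x, f x ∈ Set.Icc (0 : ℝ) 1) ∧ ∀ x y, |f x - f y| ≤ L * dist x y

/-- Margin condition with near-optimality dimension `α` and constant `C`: for every `r > 0` the
set of `r`-optimal points has Lebesgue measure at most `C r^(d - α)`. -/
def MarginCondition {d : ℕ} (C α : ℝ) (f : cube d → ℝ) : Prop :=
  ∀ r : ℝ, 0 < r →
    volume (Subtype.val '' {x : cube d | maxValue f - r ≤ f x}) ≤
      ENNReal.ofReal (C * r ^ ((d : ℝ) - α))

/-- A (possibly randomized) adaptive algorithm with sample budget `T`: `query t` gives the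
conditional law of the query number `t` (counted from `0`) given the transcript of the `t` earlier
rounds, and `output` gives the conditional law of the recommended point given the transcript of
all `T` rounds. Only the queries with `t < T` are ever used. -/
structure Algorithm (d T : ℕ) where
  query : (t : ℕ) → Kernel (History d t) (cube d)
  output : Kernel (History d T) (cube d)
  isMarkovKernel_query : ∀ t, IsMarkovKernel (query t)
  isMarkovKernel_output : IsMarkovKernel output

/-- The law of the transcript of the first `t` rounds when the objective is `f` and the noise
variables are independent with law `ν`. In each round a point `x` is drawn from the query rule,
an independent noise `ξ` is drawn from `ν`, and the pair `(x, f x + ξ)` is appended. -/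
noncomputable def Algorithm.historyLaw {d T : ℕ} (A : Algorithm d T) (ν : Measure ℝ)
    (f : cube d → ℝ) : (t : ℕ) → Measure (History d t)
  | 0 => Measure.dirac Fin.elim0
  | t + 1 =>
      (((A.historyLaw ν f t) ⊗ₘ (A.query t)).prod ν).map
        (fun p => (Fin.snoc p.1.1 (p.1.2, f p.1.2 + p.2) : History d (t + 1)))

/-- The law of the point recommended after `T` samples. -/
noncomputable def Algorithm.outputLaw {d T : ℕ} (A : Algorithm d T) (ν : Measure ℝ)
    (f : cube d → ℝ) : Measure (cube d) :=
  A.output ∘ₘ (A.historyLaw ν f T)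

end LipschitzOpt

/-! A small pyramid is hidden on a plateau. The null objective equals `a` on `[0,s]^d`, with `s =
ε^((d-α)/d)`, and falls off linearly outside. Each alternative adds a pyramid of height in `(ε, 4ε]`
over one of about `ε^(-α)` disjoint cells of the plateau. An `ε`-optimal point of an alternative
lies in its own cell, so success identifies the cell. One sample carries Kullback-Leibler divergence
at most `8ε²/σ²`, and only about the cell it falls in; hence about `ε^(-α) · σ²/ε²` samples are
needed. The plateau is small enough for the margin condition (`marginCondition_peak`).

The divergence `D` enters only through `exp (E₀ φ - D) ≤ E₁ (exp φ)` for bounded `φ`. This form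
passes through adaptive rounds (`exp_integral_historyLaw_sub_le`), with `D` an expected cost under
the null law. `outputLaw_real_le` extracts a two-point comparison, and `card_le_of_outputLaw` sums
it over the cells. -/

namespace LipschitzOpt

/-! ### Gaussian change of measure and the one-round divergence bound -/

/-- A Gaussian law satisfies the sub-Gaussian bound with its own variance. -/
lemma hasSubgaussianMGF_id_gaussianReal (v : ℝ≥0) :
    HasSubgaussianMGF id v (gaussianReal 0 v) where
  integrable_exp_mul t := integrable_exp_mul_gaussianReal t
  mgf_le t := by rw [mgf_id_gaussianReal]; simp

/-- Density of a Gaussian law with respect to the centred one, in terms of integrals. -/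
lemma integral_gaussianReal_shift {v : ℝ≥0} (hv : v ≠ 0) (b : ℝ) (F : ℝ → ℝ) :
    ∫ x, F (b + x) ∂gaussianReal 0 v =
      ∫ x, Real.exp (b / v * x - b ^ 2 / (2 * v)) * F x ∂gaussianReal 0 v := by
  have h : ∫ x, F (b + x) ∂gaussianReal 0 v = ∫ x, F x ∂gaussianReal b v := by
    have := gaussianReal_map_const_add (μ := 0) (v := v) b
    rw [zero_add] at this
    exact this ▸ ((MeasurableEquiv.addLeft b).measurableEmbedding.integral_map F).symm
  rw [h, integral_gaussianReal_eq_integral_smul hv, integral_gaussianReal_eq_integral_smul hv]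
  congr 1
  ext x
  have hv' : (v : ℝ) ≠ 0 := by exact_mod_cast hv
  simp only [gaussianPDFReal_def, smul_eq_mul]
  have : -(x - b) ^ 2 / (2 * (v : ℝ)) =
      -(x - 0) ^ 2 / (2 * v) + (b / v * x - b ^ 2 / (2 * v)) := by
    field_simp; ring
  rw [this, Real.exp_add]
  ring

lemma exp_integral_le_integral_exp {Ω : Type*} [MeasurableSpace Ω] {μ : Measure Ω}
    [IsProbabilityMeasure μ] {F : Ω → ℝ} (hF : Integrable F μ)
    (hF' : Integrable (fun x ↦ Real.exp (F x)) μ) :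
    Real.exp (∫ x, F x ∂μ) ≤ ∫ x, Real.exp (F x) ∂μ :=
  convexOn_exp.map_integral_le Real.continuous_exp.continuousOn isClosed_univ (by simp) hF hF'

lemma integrable_of_abs_le {Ω : Type*} [MeasurableSpace Ω] {μ : Measure Ω}
    [IsFiniteMeasure μ] {F : Ω → ℝ} (hF : Measurable F) {B : ℝ} (hB : ∀ x, |F x| ≤ B) :
    Integrable F μ :=
  .of_bound hF.aestronglyMeasurable B (.of_forall hB)

lemma abs_integral_le_of_abs_le {Ω : Type*} [MeasurableSpace Ω] {μ : Measure Ω}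
    [IsProbabilityMeasure μ] {F : Ω → ℝ} {B : ℝ} (hB : ∀ x, |F x| ≤ B) :
    |∫ x, F x ∂μ| ≤ B := by
  simpa using norm_integral_le_of_norm_le_const (μ := μ) (f := F) (C := B) (.of_forall hB)

lemma abs_exp_le_of_abs_le {z B : ℝ} (h : |z| ≤ B) : |Real.exp z| ≤ Real.exp B := by
  rw [Real.abs_exp]
  exact Real.exp_le_exp.2 (abs_le.1 h).2

/-- Variational form of the Kullback-Leibler divergence between two Gaussian laws of the same
variance. -/
lemma exp_integral_gaussianReal_sub_le {v : ℝ≥0} (hv : v ≠ 0) (b : ℝ) {F : ℝ → ℝ}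
    (hF : Measurable F) {B : ℝ} (hB : ∀ x, |F x| ≤ B) :
    Real.exp (∫ x, F x ∂gaussianReal 0 v - b ^ 2 / (2 * v)) ≤
      ∫ x, Real.exp (F (b + x)) ∂gaussianReal 0 v := by
  rw [integral_gaussianReal_shift hv b (fun x ↦ Real.exp (F x))]
  simp_rw [← Real.exp_add]
  have hFi : Integrable F (gaussianReal 0 v) := integrable_of_abs_le hF hB
  have hid : Integrable (fun x : ℝ ↦ x) (gaussianReal 0 v) := by
    exact (memLp_id_gaussianReal (μ := 0) (v := v) 1).integrable (by simp)
  have hlin : Integrable (fun x : ℝ ↦ b / v * x - b ^ 2 / (2 * v)) (gaussianReal 0 v) :=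
    (hid.const_mul _).sub (integrable_const _)
  have hint : ∫ x, (b / v * x - b ^ 2 / (2 * v) + F x) ∂gaussianReal 0 v =
      ∫ x, F x ∂gaussianReal 0 v - b ^ 2 / (2 * v) := by
    rw [integral_add hlin hFi, integral_sub (hid.const_mul _) (integrable_const _),
      integral_const_mul, integral_id_gaussianReal]
    simp; ring
  -- The exponent on the left is the mean of log-density plus `F` under the centred law, so Jensen's
  -- inequality suffices.
  rw [← hint]
  refine exp_integral_le_integral_exp (hlin.add hFi) ?_
  have h1 : Integrable (fun x : ℝ ↦ Real.exp (b / v * x)) (gaussianReal 0 v) :=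
    integrable_exp_mul_gaussianReal _
  have h2 : Integrable (fun x ↦ Real.exp (b / v * x) *
      (Real.exp (- (b ^ 2 / (2 * v))) * Real.exp (F x))) (gaussianReal 0 v) := by
    refine h1.mul_bdd (c := Real.exp (- (b ^ 2 / (2 * v))) * Real.exp B)
      (by fun_prop) (.of_forall fun x ↦ ?_)
    rw [norm_mul, Real.norm_eq_abs, Real.norm_eq_abs, Real.abs_exp]
    exact mul_le_mul_of_nonneg_left (abs_exp_le_of_abs_le (hB x)) (Real.exp_nonneg _)
  refine h2.congr (.of_forall fun x ↦ ?_)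
  simp only [← Real.exp_add]
  congr 1; ring

/-- The divergence bound for one round: a random query followed by a Gaussian observation. -/
lemma exp_integral_round_sub_le {X : Type*} [MeasurableSpace X] (μ : Measure X)
    [IsProbabilityMeasure μ] {v : ℝ≥0} (hv : v ≠ 0) {f₀ f₁ κ : X → ℝ}
    (hf₀ : Measurable f₀) (hf₁ : Measurable f₁) (hκ : Measurable κ) {K : ℝ}
    (hK : ∀ x, |κ x| ≤ K) (hκf : ∀ x, (f₁ x - f₀ x) ^ 2 / (2 * v) ≤ κ x)
    {F : X × ℝ → ℝ} (hF : Measurable F) {B : ℝ} (hB : ∀ p, |F p| ≤ B) :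
    Real.exp (∫ x, ∫ ξ, F (x, f₀ x + ξ) ∂gaussianReal 0 v ∂μ - ∫ x, κ x ∂μ) ≤
      ∫ x, ∫ ξ, Real.exp (F (x, f₁ x + ξ)) ∂gaussianReal 0 v ∂μ := by
  have hm : Measurable fun x ↦ ∫ ξ, F (x, f₀ x + ξ) ∂gaussianReal 0 v :=
    (StronglyMeasurable.integral_prod_right'
      (f := fun p : X × ℝ ↦ F (p.1, f₀ p.1 + p.2))
      (by apply Measurable.stronglyMeasurable; fun_prop)).measurable
  have hm' : Measurable fun x ↦ ∫ ξ, Real.exp (F (x, f₁ x + ξ)) ∂gaussianReal 0 v :=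
    (StronglyMeasurable.integral_prod_right'
      (f := fun p : X × ℝ ↦ Real.exp (F (p.1, f₁ p.1 + p.2)))
      (by apply Measurable.stronglyMeasurable; fun_prop)).measurable
  have hb (x : X) : |∫ ξ, F (x, f₀ x + ξ) ∂gaussianReal 0 v| ≤ B :=
    abs_integral_le_of_abs_le fun _ ↦ hB _
  have hi : Integrable (fun x ↦ ∫ ξ, F (x, f₀ x + ξ) ∂gaussianReal 0 v) μ :=
    integrable_of_abs_le hm hb
  have hκi : Integrable κ μ := integrable_of_abs_le hκ hK
  have hd (x : X) : |∫ ξ, F (x, f₀ x + ξ) ∂gaussianReal 0 v - κ x| ≤ B + K :=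
    (abs_sub _ _).trans (add_le_add (hb x) (hK x))
  rw [← integral_sub hi hκi]
  -- Jensen over the query moves the exponential inside the outer integral; the Gaussian bound then
  -- applies pointwise with shift `f₁ x - f₀ x`.
  refine (exp_integral_le_integral_exp (hi.sub hκi) (integrable_of_abs_le
    (Real.measurable_exp.comp (hm.sub hκ)) fun x ↦ abs_exp_le_of_abs_le (hd x))).trans ?_
  refine integral_mono (integrable_of_abs_le
    (Real.measurable_exp.comp (hm.sub hκ)) fun x ↦ abs_exp_le_of_abs_le (hd x))
    (integrable_of_abs_le hm' fun x ↦ abs_integral_le_of_abs_le fun ξ ↦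
      abs_exp_le_of_abs_le (hB _)) fun x ↦ ?_
  have := exp_integral_gaussianReal_sub_le hv (f₁ x - f₀ x)
    (F := fun ξ ↦ F (x, f₀ x + ξ)) (by fun_prop) (fun ξ ↦ hB _)
  refine (Real.exp_le_exp.2 (sub_le_sub_left (hκf x) _)).trans (this.trans_eq ?_)
  congr 1; ext ξ; congr 3; ring

lemma measurable_finSnoc {E : Type*} [MeasurableSpace E] (t : ℕ) :
    Measurable fun p : (Fin t → E) × E ↦ (Fin.snoc p.1 p.2 : Fin (t + 1) → E) := by
  rw [measurable_pi_iff]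
  refine Fin.lastCases ?_ fun i ↦ ?_
  · simpa using measurable_snd
  · simpa [Function.comp_def] using (measurable_pi_apply i).comp measurable_fst

/-! ### Transcript laws, chain rule and testing bounds -/

section Transcripts

variable {d T : ℕ} (A : Algorithm d T) {ν : Measure ℝ} [IsProbabilityMeasure ν]

instance (t : ℕ) : IsMarkovKernel (A.query t) := A.isMarkovKernel_query t

instance : IsMarkovKernel A.output := A.isMarkovKernel_output

lemma measurable_appendRound {f : cube d → ℝ} (hf : Measurable f) (t : ℕ) :
    Measurable fun p : (History d t × cube d) × ℝ ↦
      (Fin.snoc p.1.1 (p.1.2, f p.1.2 + p.2) : History d (t + 1)) :=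
  (measurable_finSnoc t).comp
    (f := fun p : (History d t × cube d) × ℝ ↦ (p.1.1, (p.1.2, f p.1.2 + p.2))) (by fun_prop)

lemma isProbabilityMeasure_historyLaw {f : cube d → ℝ} (hf : Measurable f) (t : ℕ) :
    IsProbabilityMeasure (A.historyLaw ν f t) := by
  induction t with
  | zero => exact Measure.dirac.isProbabilityMeasure
  | succ t ih =>
    exact Measure.isProbabilityMeasure_map (measurable_appendRound hf t).aemeasurable

/-- The expectation over `t + 1` rounds, with the last round integrated first. -/
lemma integral_historyLaw_succ {f : cube d → ℝ} (hf : Measurable f) (t : ℕ)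
    {φ : History d (t + 1) → ℝ} (hφ : Measurable φ) {B : ℝ} (hB : ∀ h, |φ h| ≤ B) :
    ∫ h, φ h ∂A.historyLaw ν f (t + 1) =
      ∫ h, ∫ x, ∫ ξ, φ (Fin.snoc h (x, f x + ξ)) ∂ν ∂A.query t h ∂A.historyLaw ν f t := by
  have := isProbabilityMeasure_historyLaw A (ν := ν) hf t
  have hm := measurable_appendRound hf t
  have hφm : Measurable fun p : (History d t × cube d) × ℝ ↦
      φ (Fin.snoc p.1.1 (p.1.2, f p.1.2 + p.2)) := hφ.comp hm
  rw [Algorithm.historyLaw, integral_map hm.aemeasurable hφ.aestronglyMeasurable,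
    integral_prod _ (integrable_of_abs_le hφm fun _ ↦ hB _), Measure.integral_compProd]
  exact integrable_of_abs_le hφm.stronglyMeasurable.integral_prod_right'.measurable
    fun _ ↦ abs_integral_le_of_abs_le fun _ ↦ hB _

/-- The expected total of the cost `κ` over the queries of the first `t` rounds. -/
noncomputable def Algorithm.expectedCost (A : Algorithm d T) (ν : Measure ℝ) (f κ : cube d → ℝ)
    (t : ℕ) : ℝ :=
  ∑ i ∈ Finset.range t, ∫ h, ∫ x, κ x ∂A.query i h ∂A.historyLaw ν f i

/-- All costs are averaged under the same law, so the sum over `k` moves inside the expectations,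
where each query pays at most `K` for all `k` together. -/
lemma sum_expectedCost_le {f : cube d → ℝ} (hf : Measurable f) {ι : Type*} (s : Finset ι)
    {κ : ι → cube d → ℝ} (hκ : ∀ k, Measurable (κ k)) {B : ℝ} (hB : ∀ k x, |κ k x| ≤ B) {K : ℝ}
    (hK : ∀ x, ∑ k ∈ s, κ k x ≤ K) (t : ℕ) :
    ∑ k ∈ s, A.expectedCost ν f (κ k) t ≤ t * K := by
  unfold Algorithm.expectedCost
  rw [Finset.sum_comm]
  refine (Finset.sum_le_card_nsmul _ _ K fun i _ ↦ ?_).trans_eq (by simp)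
  have := isProbabilityMeasure_historyLaw A (ν := ν) hf i
  have hint (k : ι) (h : History d i) : Integrable (κ k) (A.query i h) :=
    integrable_of_abs_le (hκ k) (hB k)
  have hint' (k : ι) :
      Integrable (fun h ↦ ∫ x, κ k x ∂A.query i h) (A.historyLaw ν f i) :=
    integrable_of_abs_le (hκ k).stronglyMeasurable.integral_kernel.measurable
      fun h ↦ abs_integral_le_of_abs_le (hB k)
  rw [← integral_finsetSum _ fun k _ ↦ hint' k]
  refine (integral_mono (integrable_finsetSum _ fun k _ ↦ hint' k)
    (integrable_const K) fun h ↦ ?_).trans_eq (by simp)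
  simp only
  rw [← integral_finsetSum _ fun k _ ↦ hint k h]
  exact (integral_mono (integrable_finsetSum _ fun k _ ↦ hint k h)
    (integrable_const K) hK).trans_eq (by simp)

/-- The divergence bound for the transcripts of an algorithm run on two objectives: the chain rule
over the rounds, in variational form. -/
lemma exp_integral_historyLaw_sub_le {v : ℝ≥0} (hv : v ≠ 0) {f₀ f₁ κ : cube d → ℝ}
    (hf₀ : Measurable f₀) (hf₁ : Measurable f₁) (hκ : Measurable κ) {K : ℝ}
    (hK : ∀ x, |κ x| ≤ K) (hκf : ∀ x, (f₁ x - f₀ x) ^ 2 / (2 * v) ≤ κ x) (t : ℕ) :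
    ∀ {φ : History d t → ℝ}, Measurable φ → ∀ {B : ℝ}, (∀ h, |φ h| ≤ B) →
    Real.exp (∫ h, φ h ∂A.historyLaw (gaussianReal 0 v) f₀ t -
        A.expectedCost (gaussianReal 0 v) f₀ κ t) ≤
      ∫ h, Real.exp (φ h) ∂A.historyLaw (gaussianReal 0 v) f₁ t := by
  induction t with
  | zero =>
    intro φ hφ B hB
    simp only [Algorithm.historyLaw, Algorithm.expectedCost]
    rw [integral_dirac' _ _ hφ.stronglyMeasurable,
      integral_dirac' _ _ hφ.exp.stronglyMeasurable]
    simp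
  | succ t ih =>
    intro φ hφ B hB
    set ν := gaussianReal 0 v
    have := isProbabilityMeasure_historyLaw A (ν := ν) hf₀ t
    have hBexp (h) : |Real.exp (φ h)| ≤ Real.exp B := abs_exp_le_of_abs_le (hB h)
    rw [integral_historyLaw_succ A hf₀ t hφ hB,
      integral_historyLaw_succ A hf₁ t hφ.exp hBexp]
    set J : History d t → ℝ := fun h ↦
      ∫ x, ∫ ξ, Real.exp (φ (Fin.snoc h (x, f₁ x + ξ))) ∂ν ∂A.query t h
    have hJm : Measurable J :=
      ((hφ.exp.comp
        (measurable_appendRound hf₁ t)).stronglyMeasurable.integral_prod_right'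
        (ν := ν)).integral_kernel_prod_right'.measurable
    have hint (h : History d t) (x : cube d) :
        Integrable (fun ξ ↦ Real.exp (φ (Fin.snoc h (x, f₁ x + ξ)))) ν :=
      integrable_of_abs_le (((hφ.exp.comp (measurable_appendRound hf₁ t))).comp
        (measurable_prodMk_left (x := (h, x)))) fun _ ↦ hBexp _
    have hint' (h : History d t) :
        Integrable (fun x ↦ ∫ ξ, Real.exp (φ (Fin.snoc h (x, f₁ x + ξ))) ∂ν) (A.query t h) :=
      integrable_of_abs_le (((hφ.exp.comp
        (measurable_appendRound hf₁ t)).stronglyMeasurable.integral_prod_right'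
        (ν := ν)).measurable.comp measurable_prodMk_left)
        fun _ ↦ abs_integral_le_of_abs_le fun _ ↦ hBexp _
    have hJlow (h) : Real.exp (-B) ≤ J h := by
      have h1 (x : cube d) :
          Real.exp (-B) ≤ ∫ ξ, Real.exp (φ (Fin.snoc h (x, f₁ x + ξ))) ∂ν := by
        refine Eq.trans_le (by simp) (integral_mono (integrable_const (Real.exp (-B))) (hint h x)
          fun ξ ↦ Real.exp_le_exp.2 (abs_le.1 (hB _)).1)
      exact Eq.trans_le (by simp) (integral_mono (integrable_const (Real.exp (-B))) (hint' h) h1)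
    have hJup (h) : J h ≤ Real.exp B :=
      (abs_le.1 (abs_integral_le_of_abs_le fun x ↦ abs_integral_le_of_abs_le fun ξ ↦
        hBexp _)).2
    have hJpos (h) : 0 < J h := (Real.exp_pos _).trans_le (hJlow h)
    have hψB (h) : |Real.log (J h)| ≤ B := abs_le.2
      ⟨(Real.le_log_iff_exp_le (hJpos h)).2 (hJlow h),
        (Real.log_le_iff_le_exp (hJpos h)).2 (hJup h)⟩
    -- The last round is folded into the test function `log J`, bounded by `B` because `J` lies
    -- between `exp (-B)` and `exp B`. What remains is the one-round bound conditional on the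
    -- transcript.
    have key := ih hJm.log hψB
    simp_rw [Real.exp_log (hJpos _)] at key
    refine le_trans (Real.exp_le_exp.2 ?_) key
    have hIm : Measurable fun h : History d t ↦
        ∫ x, ∫ ξ, φ (Fin.snoc h (x, f₀ x + ξ)) ∂ν ∂A.query t h :=
      ((hφ.comp (measurable_appendRound hf₀ t)).stronglyMeasurable.integral_prod_right'
        (ν := ν)).integral_kernel_prod_right'.measurable
    have hIi := integrable_of_abs_le (μ := A.historyLaw ν f₀ t) hIm fun h ↦
      abs_integral_le_of_abs_le fun x ↦ abs_integral_le_of_abs_le fun ξ ↦ hB _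
    have hκi : Integrable (fun h ↦ ∫ x, κ x ∂A.query t h) (A.historyLaw ν f₀ t) :=
      integrable_of_abs_le hκ.stronglyMeasurable.integral_kernel.measurable
        fun h ↦ abs_integral_le_of_abs_le hK
    have hcost : A.expectedCost ν f₀ κ (t + 1) = (∫ h, ∫ x, κ x ∂A.query t h ∂A.historyLaw ν f₀ t) +
        A.expectedCost ν f₀ κ t := by
      rw [Algorithm.expectedCost, Finset.sum_range_succ, add_comm, Algorithm.expectedCost]
    rw [hcost, ← sub_sub, ← integral_sub hIi hκi]
    refine sub_le_sub_right (integral_mono (hIi.sub hκi)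
      (integrable_of_abs_le hJm.log hψB) fun h ↦ ?_) _
    exact (Real.le_log_iff_exp_le (hJpos h)).2 (exp_integral_round_sub_le (A.query t h) hv hf₀ hf₁
      hκ hK hκf (F := fun p ↦ φ (Fin.snoc h p))
      (hφ.comp ((measurable_finSnoc t).comp measurable_prodMk_left)) fun _ ↦ hB _)

lemma isProbabilityMeasure_outputLaw {f : cube d → ℝ} (hf : Measurable f) :
    IsProbabilityMeasure (A.outputLaw ν f) := by
  have := isProbabilityMeasure_historyLaw A (ν := ν) hf T
  unfold Algorithm.outputLaw
  infer_instance

lemma outputLaw_real_eq_integral {f : cube d → ℝ} (hf : Measurable f) {S : Set (cube d)}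
    (hS : MeasurableSet S) :
    (A.outputLaw ν f).real S = ∫ h, (A.output h).real S ∂A.historyLaw ν f T := by
  have := isProbabilityMeasure_historyLaw A (ν := ν) hf T
  rw [measureReal_def, Algorithm.outputLaw, Measure.bind_apply hS A.output.aemeasurable]
  exact (integral_toReal (A.output.measurable_coe hS).aemeasurable
    (.of_forall fun _ ↦ measure_lt_top _ _)).symm

/-- Two-point comparison: the probability of an event under the alternative objective is at most
twice the sum of its probability under the null objective and the divergence. -/
lemma outputLaw_real_le {v : ℝ≥0} (hv : v ≠ 0) {f₀ f₁ κ : cube d → ℝ}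
    (hf₀ : Measurable f₀) (hf₁ : Measurable f₁) (hκ : Measurable κ) {K : ℝ}
    (hK : ∀ x, |κ x| ≤ K) (hκf : ∀ x, (f₁ x - f₀ x) ^ 2 / (2 * v) ≤ κ x)
    {S : Set (cube d)} (hS : MeasurableSet S) :
    (A.outputLaw (gaussianReal 0 v) f₁).real S ≤
      2 * ((A.outputLaw (gaussianReal 0 v) f₀).real S +
        A.expectedCost (gaussianReal 0 v) f₀ κ T) := by
  rw [outputLaw_real_eq_integral A hf₀ hS, outputLaw_real_eq_integral A hf₁ hS]
  have := isProbabilityMeasure_historyLaw A (ν := gaussianReal 0 v) hf₁ T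
  have hw : Measurable fun h ↦ (A.output h).real S := (A.output.measurable_coe hS).ennreal_toReal
  have hw0 (h) : 0 ≤ (A.output h).real S := measureReal_nonneg
  have hw1 (h) : (A.output h).real S ≤ 1 := measureReal_le_one
  have hwB (h) : |-(A.output h).real S| ≤ 1 := by
    rw [abs_neg, abs_of_nonneg (hw0 h)]; exact hw1 h
  -- The test function is minus the conditional probability of recommending a point of `S`. Below,
  -- `exp (-w) ≤ 1 - w / 2` on `[0,1]` linearises the alternative side, whence the factor 2, and `1
  -- + y ≤ exp y` the null side.
  have key := exp_integral_historyLaw_sub_le A hv hf₀ hf₁ hκ hK hκf T hw.neg hwB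
  simp only [Pi.neg_apply] at key
  rw [integral_neg] at key
  have hexp (w : ℝ) (h0 : 0 ≤ w) (h1 : w ≤ 1) : Real.exp (-w) ≤ 1 - w / 2 := by
    have h2 : (1 - w / 2) * Real.exp w ≥ 1 := by
      nlinarith [mul_le_mul_of_nonneg_left (Real.add_one_le_exp w) (by linarith : 0 ≤ 1 - w / 2)]
    have h3 : Real.exp w * Real.exp (-w) = 1 := by rw [← Real.exp_add]; simp
    nlinarith [Real.exp_pos (-w)]
  have hwi : Integrable (fun h ↦ (A.output h).real S)
      (A.historyLaw (gaussianReal 0 v) f₁ T) :=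
    integrable_of_abs_le hw fun h ↦ by simpa using hwB h
  have hup : ∫ h, Real.exp (-(A.output h).real S) ∂A.historyLaw (gaussianReal 0 v) f₁ T ≤
      1 - (∫ h, (A.output h).real S ∂A.historyLaw (gaussianReal 0 v) f₁ T) / 2 := by
    refine (integral_mono (integrable_of_abs_le hw.neg.exp fun h ↦ abs_exp_le_of_abs_le (hwB h))
      ((integrable_const 1).sub (hwi.div_const 2)) fun h ↦ hexp _ (hw0 h) (hw1 h)).trans_eq ?_
    rw [integral_sub' (integrable_const 1) (hwi.div_const 2), integral_div]
    simp
  have := Real.add_one_le_exp (-(∫ h, (A.output h).real S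
    ∂A.historyLaw (gaussianReal 0 v) f₀ T) - A.expectedCost (gaussianReal 0 v) f₀ κ T)
  linarith

/-- Many-hypotheses bound: if each of finitely many alternatives puts mass at least `2 / 3` on its
own set, the sets being disjoint, then the number of alternatives is controlled by the number of
rounds times a uniform bound on the pointwise sum of the divergences. -/
lemma card_le_of_outputLaw {ι : Type*} [Fintype ι] {v : ℝ≥0} (hv : v ≠ 0) {f₀ : cube d → ℝ}
    {f κ : ι → cube d → ℝ} (hf₀ : Measurable f₀) (hf : ∀ k, Measurable (f k))
    (hκ : ∀ k, Measurable (κ k)) {B : ℝ} (hB : ∀ k x, |κ k x| ≤ B)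
    (hκf : ∀ k x, (f k x - f₀ x) ^ 2 / (2 * v) ≤ κ k x) {K : ℝ} (hK : ∀ x, ∑ k, κ k x ≤ K)
    {S : ι → Set (cube d)} (hS : ∀ k, MeasurableSet (S k))
    (hdisj : Pairwise (Function.onFun Disjoint S))
    (hsucc : ∀ k, 2 / 3 ≤ (A.outputLaw (gaussianReal 0 v) (f k)).real (S k)) :
    (Fintype.card ι : ℝ) ≤ 3 * (1 + T * K) := by
  have := isProbabilityMeasure_outputLaw A (ν := gaussianReal 0 v) hf₀
  have h1 : ∑ k, (A.outputLaw (gaussianReal 0 v) f₀).real (S k) ≤ 1 := by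
    rw [← measureReal_biUnion_finset (fun i _ j _ hij ↦ hdisj hij) fun k _ ↦ hS k]
    exact measureReal_le_one
  have h2 := sum_expectedCost_le A (ν := gaussianReal 0 v) hf₀ Finset.univ hκ hB hK T
  have h3 : ∑ _k : ι, (1 / 3 : ℝ) ≤ ∑ k, ((A.outputLaw (gaussianReal 0 v) f₀).real (S k) +
      A.expectedCost (gaussianReal 0 v) f₀ (κ k) T) :=
    Finset.sum_le_sum fun k _ ↦ by
      have := outputLaw_real_le A hv hf₀ (hf k) (hκ k) (hB k) (hκf k) (hS k)
      linarith [hsucc k]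
  rw [Finset.sum_add_distrib, Finset.sum_const, nsmul_eq_mul, Finset.card_univ] at h3
  linarith

end Transcripts

/-! ### The plateau, the pyramids and the margin condition -/

section Peaks

variable {d : ℕ} {a s ρ : ℝ} {c : Fin d → ℝ}

/-- The function equal to `a` on the subcube `[0,s]^d` and decreasing with slope `a` in the
supremum distance to that subcube. -/
noncomputable def plateau (a s : ℝ) (x : cube d) : ℝ := a * (1 - max 0 (‖x.1.ofLp‖ - s))

/-- The pyramid of slope `a` over the supremum ball of centre `c` and radius `ρ`. -/
noncomputable def bump (a ρ : ℝ) (c : Fin d → ℝ) (x : cube d) : ℝ :=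
  a * max 0 (ρ - ‖x.1.ofLp - c‖)

/-- The plateau with a pyramid on top of it. -/
noncomputable def peak (a s ρ : ℝ) (c : Fin d → ℝ) (x : cube d) : ℝ :=
  plateau a s x + bump a ρ c x

/-- The supremum norm makes pyramid supports grid cells and encloses superlevel sets in boxes; this
comparison recovers Euclidean Lipschitz bounds. -/
lemma norm_ofLp_sub_le_dist (x y : cube d) : ‖x.1.ofLp - y.1.ofLp‖ ≤ dist x y := by
  rw [Subtype.dist_eq, dist_eq_norm, pi_norm_le_iff_of_nonneg (norm_nonneg _)]
  exact fun i ↦ PiLp.norm_apply_le (x.1 - y.1) i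

lemma norm_ofLp_le_one (x : cube d) : ‖x.1.ofLp‖ ≤ 1 := by
  rw [pi_norm_le_iff_of_nonneg zero_le_one]
  intro i
  rw [Real.norm_eq_abs, abs_of_nonneg (x.2 i).1]
  exact (x.2 i).2

@[fun_prop]
lemma measurable_plateau : Measurable (plateau a s : cube d → ℝ) := by
  have : Continuous (plateau a s : cube d → ℝ) := by unfold plateau; fun_prop
  exact this.measurable

@[fun_prop]
lemma measurable_bump : Measurable (bump a ρ c) := by
  have : Continuous (bump a ρ c) := by unfold bump; fun_prop
  exact this.measurable

lemma measurable_peak : Measurable (peak a s ρ c) := measurable_plateau.add measurable_bump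

lemma plateau_le (ha : 0 ≤ a) (x : cube d) : plateau a s x ≤ a :=
  mul_le_of_le_one_right ha (by linarith [le_max_left 0 (‖x.1.ofLp‖ - s)])

lemma plateau_nonneg (ha : 0 ≤ a) (hs : 0 ≤ s) (x : cube d) : 0 ≤ plateau a s x := by
  refine mul_nonneg ha (sub_nonneg.2 (max_le zero_le_one ?_))
  linarith [norm_ofLp_le_one x]

lemma bump_nonneg (ha : 0 ≤ a) (x : cube d) : 0 ≤ bump a ρ c x :=
  mul_nonneg ha (le_max_left _ _)

lemma bump_le (ha : 0 ≤ a) (hρ : 0 ≤ ρ) (x : cube d) : bump a ρ c x ≤ a * ρ :=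
  mul_le_mul_of_nonneg_left (max_le hρ (sub_le_self _ (norm_nonneg _))) ha

lemma bump_eq_zero {x : cube d} (h : ρ ≤ ‖x.1.ofLp - c‖) : bump a ρ c x = 0 := by
  rw [bump, max_eq_left (sub_nonpos.2 h), mul_zero]

lemma abs_plateau_sub_le (ha : 0 ≤ a) (x y : cube d) :
    |plateau a s x - plateau a s y| ≤ a * dist x y := by
  rw [plateau, plateau, ← mul_sub, abs_mul, abs_of_nonneg ha]
  refine mul_le_mul_of_nonneg_left ?_ ha
  have h := abs_max_sub_max_le_abs (‖y.1.ofLp‖ - s) (‖x.1.ofLp‖ - s) 0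
  have h2 := (abs_norm_sub_norm_le y.1.ofLp x.1.ofLp).trans (norm_ofLp_sub_le_dist y x)
  rw [dist_comm y x] at h2
  rw [sub_sub_sub_cancel_left, max_comm, max_comm 0]
  exact h.trans (by simpa using h2)

lemma abs_bump_sub_le (ha : 0 ≤ a) (x y : cube d) :
    |bump a ρ c x - bump a ρ c y| ≤ a * dist x y := by
  rw [bump, bump, ← mul_sub, abs_mul, abs_of_nonneg ha]
  refine mul_le_mul_of_nonneg_left ?_ ha
  have h := abs_max_sub_max_le_abs (ρ - ‖x.1.ofLp - c‖) (ρ - ‖y.1.ofLp - c‖) 0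
  have h2 := (abs_norm_sub_norm_le (y.1.ofLp - c) (x.1.ofLp - c))
  rw [sub_sub_sub_cancel_right] at h2
  have h3 := norm_ofLp_sub_le_dist y x
  rw [dist_comm y x] at h3
  rw [max_comm, max_comm 0]
  rw [sub_sub_sub_cancel_left] at h
  exact h.trans (h2.trans h3)

lemma isLipschitzObjective_peak {L : ℝ} (ha : 0 ≤ a) (haL : 2 * a ≤ L) (ha1 : 2 * a ≤ 1)
    (hs : 0 ≤ s) (hρ : 0 ≤ ρ) (hρ1 : ρ ≤ 1) : IsLipschitzObjective L (peak a s ρ c) := by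
  refine ⟨fun x ↦ ⟨add_nonneg (plateau_nonneg ha hs x) (bump_nonneg ha x), ?_⟩, fun x y ↦ ?_⟩
  · have h1 := plateau_le (s := s) ha x
    have h2 := bump_le (c := c) ha hρ x
    have h3 : a * ρ ≤ a := mul_le_of_le_one_right ha hρ1
    unfold peak
    linarith
  · have h1 := abs_plateau_sub_le (s := s) ha x y
    have h2 := abs_bump_sub_le (ρ := ρ) (c := c) ha x y
    have h3 : 2 * a * dist x y ≤ L * dist x y := mul_le_mul_of_nonneg_right haL dist_nonneg
    unfold peak
    rw [add_sub_add_comm]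
    exact (abs_add_le _ _).trans (by linarith)

lemma peak_le (ha : 0 ≤ a) (hρ : 0 ≤ ρ) (x : cube d) : peak a s ρ c x ≤ a + a * ρ :=
  add_le_add (plateau_le ha x) (bump_le ha hρ x)

/-- The centre lies on the plateau, so both summands attain their upper bounds there. -/
lemma maxValue_peak (ha : 0 ≤ a) (hρ : 0 ≤ ρ) (hs : 0 ≤ s) (hs1 : s ≤ 1)
    (hc : ∀ i, c i ∈ Set.Icc 0 s) :
    maxValue (peak a s ρ c) = a + a * ρ := by
  have hmem : WithLp.toLp 2 c ∈ cube d := fun i ↦ ⟨(hc i).1, (hc i).2.trans hs1⟩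
  have hval : peak a s ρ c ⟨WithLp.toLp 2 c, hmem⟩ = a + a * ρ := by
    have hmax : max 0 (‖c‖ - s) = 0 := by
      refine max_eq_left (sub_nonpos.2 ((pi_norm_le_iff_of_nonneg hs).2 fun j ↦ ?_))
      rw [Real.norm_eq_abs, abs_of_nonneg (hc j).1]
      exact (hc j).2
    simp [peak, plateau, bump, hmax, hρ]
  have : Nonempty (cube d) := ⟨⟨_, hmem⟩⟩
  refine IsLUB.ciSup_eq (f := peak a s ρ c) (IsGreatest.isLUB ⟨⟨_, hval⟩, ?_⟩)
  rintro _ ⟨x, rfl⟩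
  exact peak_le ha hρ x

/-- Off the pyramid the value is at most `a`, which costs a regret of at least `a * ρ > ε`. -/
lemma norm_sub_lt_of_regret_peak_le {ε : ℝ} (ha : 0 ≤ a)
    (hmax : maxValue (peak a s ρ c) = a + a * ρ) (hε : ε < a * ρ) {x : cube d} (hx : regret (peak a s ρ c) x ≤ ε) : ‖x.1.ofLp - c‖ < ρ := by
  by_contra! h
  have h1 := plateau_le (s := s) ha x
  rw [regret, hmax, peak, bump_eq_zero h] at hx
  linarith

/-- A near-optimal set of small level is contained in the ball around the peak. -/
lemma norm_sub_le_of_le_peak {r : ℝ} (ha : 0 < a) (hr : r < a * ρ) {x : cube d}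
    (hx : a + a * ρ - r ≤ peak a s ρ c x) : ‖x.1.ofLp - c‖ ≤ r / a := by
  have h1 := plateau_le (s := s) ha.le x
  have h2 : a * ρ - r ≤ bump a ρ c x := by rw [peak] at hx; linarith
  rw [le_div_iff₀ ha]
  rcases le_total ρ ‖x.1.ofLp - c‖ with h | h
  · rw [bump_eq_zero h] at h2; linarith
  · rw [bump, max_eq_right (sub_nonneg.2 h)] at h2; linarith

/-- A near-optimal set is contained in a neighbourhood of the plateau. -/
lemma norm_le_of_le_peak {r : ℝ} (ha : 0 < a) (hρ : 0 ≤ ρ) {x : cube d}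
    (hx : a + a * ρ - r ≤ peak a s ρ c x) : ‖x.1.ofLp‖ ≤ s + r / a := by
  have h1 := bump_le (c := c) ha.le hρ x
  have h2 : a - r ≤ plateau a s x := by rw [peak] at hx; linarith
  have h3 : a * (‖x.1.ofLp‖ - s) ≤ r := by
    have := mul_le_mul_of_nonneg_left (le_max_right 0 (‖x.1.ofLp‖ - s)) ha.le
    rw [plateau] at h2
    linarith
  rw [← sub_le_iff_le_add', le_div_iff₀ ha]
  linarith

lemma volume_image_le_of_subset_box {S : Set (cube d)} {l u : Fin d → ℝ} {w : ℝ} (hw : 0 ≤ w)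
    (hS : ∀ x ∈ S, ∀ i, x.1 i ∈ Set.Icc (l i) (u i)) (hlu : ∀ i, u i - l i ≤ w) :
    volume (Subtype.val '' S) ≤ ENNReal.ofReal (w ^ d) := by
  have hsub : Subtype.val '' S ⊆ (WithLp.ofLp : EuclideanSpace ℝ (Fin d) → _) ⁻¹' Set.Icc l u := by
    rintro _ ⟨x, hx, rfl⟩
    exact ⟨fun i ↦ (hS x hx i).1, fun i ↦ (hS x hx i).2⟩
  refine (measure_mono hsub).trans ?_
  rw [(PiLp.volume_preserving_ofLp (Fin d)).measure_preimage measurableSet_Icc.nullMeasurableSet,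
    Real.volume_Icc_pi, ENNReal.ofReal_pow hw]
  exact (Finset.prod_le_pow_card _ _ _ fun i _ ↦ ENNReal.ofReal_le_ofReal (hlu i)).trans_eq
    (by simp)

/-- With `β = (d - α) / d`, the bound is the volume of a cube of side `2 / a * r ^ β`. For `r > 1`
this side exceeds 1. For `r < a * ρ` only a ball of radius `r / a` around the peak counts, and `r ≤
r ^ β`. In between, the set lies in `[0, s + r / a]^d`, and `s ≤ (a * ρ) ^ β ≤ r ^ β`. -/
lemma marginCondition_peak {α : ℝ} (hα : 0 < α) (hαd : α ≤ d) (ha : 0 < a) (ha1 : a ≤ 1)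
    (hρ : 0 < ρ) (hs : s ≤ (a * ρ) ^ (((d : ℝ) - α) / d))
    (hmax : maxValue (peak a s ρ c) = a + a * ρ) :
    MarginCondition ((2 / a) ^ d) α (peak a s ρ c) := by
  intro r hr
  have hd : (0 : ℝ) < d := hα.trans_le hαd
  set β : ℝ := ((d : ℝ) - α) / d
  have hβ0 : 0 ≤ β := div_nonneg (sub_nonneg.2 hαd) hd.le
  have hβ1 : β ≤ 1 := (div_le_one hd).2 (by linarith)
  have hrβ : 0 < r ^ β := Real.rpow_pos_of_pos hr β
  have ha2 : 2 ≤ 2 / a := by rw [le_div_iff₀ ha]; linarith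
  have hside : (2 / a) ^ d * r ^ ((d : ℝ) - α) = (2 / a * r ^ β) ^ d := by
    rw [mul_pow, ← Real.rpow_natCast (r ^ β), ← Real.rpow_mul hr.le, div_mul_cancel₀ _ hd.ne']
  rw [hside, hmax]
  have hw : 0 ≤ 2 / a * r ^ β := by positivity
  rcases lt_or_ge 1 r with h1 | h1
  · refine volume_image_le_of_subset_box (l := 0) (u := 1) hw (fun x _ i ↦ x.2 i) fun i ↦ ?_
    have := Real.one_le_rpow h1.le hβ0
    simp only [Pi.one_apply, Pi.zero_apply]
    nlinarith
  have hrr : r ≤ r ^ β := by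
    simpa using Real.rpow_le_rpow_of_exponent_ge hr h1 hβ1
  rcases lt_or_ge r (a * ρ) with h | h
  · refine volume_image_le_of_subset_box (l := fun i ↦ c i - r / a) (u := fun i ↦ c i + r / a) hw
      (fun x hx i ↦ ?_) fun i ↦ ?_
    · have := (norm_le_pi_norm (x.1.ofLp - c) i).trans (norm_sub_le_of_le_peak ha h hx)
      rw [Real.norm_eq_abs, Pi.sub_apply, abs_le] at this
      constructor <;> linarith
    · calc c i + r / a - (c i - r / a) = 2 / a * r := by ring
        _ ≤ _ := by gcongr
  · refine volume_image_le_of_subset_box (l := 0) (u := fun i ↦ s + r / a) hw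
      (fun x hx i ↦ ⟨(x.2 i).1, ?_⟩) fun i ↦ ?_
    · exact (le_abs_self _).trans
        ((norm_le_pi_norm x.1.ofLp i).trans (norm_le_of_le_peak ha hρ.le hx))
    · have hsr : s ≤ r ^ β := hs.trans (Real.rpow_le_rpow (by positivity) h hβ0)
      have h2 : r / a ≤ r ^ β / a := by gcongr
      have h3 : r ^ β ≤ r ^ β / a := by
        rw [le_div_iff₀ ha]; exact mul_le_of_le_one_right hrβ.le ha1
      calc s + r / a - 0 ≤ r ^ β / a + r ^ β / a := by linarith
        _ = 2 / a * r ^ β := by ring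

end Peaks

/-! ### The grid of hypotheses -/

/-- The centres of the cells of the regular grid with `m ^ d` cells of side `2 * ρ`. -/
def gridCenter {d m : ℕ} (ρ : ℝ) (k : Fin d → Fin m) : Fin d → ℝ := fun i ↦ (2 * (k i : ℕ) + 1) * ρ

lemma gridCenter_mem {d m : ℕ} {ρ : ℝ} (hρ : 0 ≤ ρ) (k : Fin d → Fin m) (i : Fin d) :
    gridCenter ρ k i ∈ Set.Icc 0 (2 * m * ρ) := by
  have h : ((k i : ℕ) : ℝ) + 1 ≤ m := by exact_mod_cast (k i).2
  exact ⟨by unfold gridCenter; positivity, mul_le_mul_of_nonneg_right (by linarith) hρ⟩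

lemma eq_of_norm_sub_gridCenter_lt {d m : ℕ} {ρ : ℝ} {k l : Fin d → Fin m} {x : Fin d → ℝ}
    (hk : ‖x - gridCenter ρ k‖ < ρ) (hl : ‖x - gridCenter ρ l‖ < ρ) : k = l := by
  have hρ : 0 < ρ := (norm_nonneg _).trans_lt hk
  ext i
  have h1 := abs_lt.1 ((norm_le_pi_norm _ i).trans_lt hk)
  have h2 := abs_lt.1 ((norm_le_pi_norm _ i).trans_lt hl)
  simp only [Pi.sub_apply, gridCenter] at h1 h2
  have h3 : ((k i : ℕ) : ℝ) < (l i : ℕ) + 1 := by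
    by_contra! h; nlinarith
  have h4 : ((l i : ℕ) : ℝ) < (k i : ℕ) + 1 := by
    by_contra! h; nlinarith
  have h5 : (k i : ℕ) < l i + 1 := by exact_mod_cast h3
  have h6 : (l i : ℕ) < k i + 1 := by exact_mod_cast h4
  omega

/-- The sample complexity bound for the family of peaks over a grid. -/
lemma card_grid_le {d T m : ℕ} (A : Algorithm d T) {v : ℝ≥0} (hv : v ≠ 0) {a s ρ b : ℝ}
    (ha : 0 ≤ a) (hρ : 0 ≤ ρ) (hb : a * ρ ≤ b) {S : (Fin d → Fin m) → Set (cube d)}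
    (hS : ∀ k, ∀ x ∈ S k, ‖x.1.ofLp - gridCenter ρ k‖ < ρ)
    (hsucc : ∀ k, (2 / 3 : ℝ≥0∞) ≤
      A.outputLaw (gaussianReal 0 v) (peak a s ρ (gridCenter ρ k)) (S k)) :
    ((m ^ d : ℕ) : ℝ) ≤ 3 * (1 + T * (b ^ 2 / (2 * v))) := by
  -- The sets `S k` are enlarged to open cells, which are measurable and disjoint. Each point then
  -- pays the cost of at most one cell.
  set V : (Fin d → Fin m) → Set (cube d) := fun k ↦ {x | ‖x.1.ofLp - gridCenter ρ k‖ < ρ}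
  have hV (k) : MeasurableSet (V k) := (isOpen_lt (by fun_prop) continuous_const).measurableSet
  have hdisj : Pairwise (Function.onFun Disjoint V) := fun k l hkl ↦
    Set.disjoint_left.2 fun x hx hx' ↦ hkl (eq_of_norm_sub_gridCenter_lt hx hx')
  have hK : 0 ≤ b ^ 2 / (2 * (v : ℝ)) := by positivity
  have := card_le_of_outputLaw A hv (f₀ := plateau a s)
    (f := fun k ↦ peak a s ρ (gridCenter ρ k))
    (κ := fun k ↦ (V k).indicator fun _ ↦ b ^ 2 / (2 * v)) (B := b ^ 2 / (2 * v))
    (K := b ^ 2 / (2 * v)) (S := V) measurable_plateau (fun k ↦ measurable_peak)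
    (fun k ↦ measurable_const.indicator (hV k)) (fun k x ↦ ?_) (fun k x ↦ ?_) (fun x ↦ ?_) hV hdisj
    fun k ↦ ?_
  · simpa using this
  · by_cases h : x ∈ V k <;> simp [h, abs_of_nonneg hK, hK]
  · rw [peak, add_sub_cancel_left]
    by_cases h : x ∈ V k
    · rw [Set.indicator_of_mem h]
      have h1 := bump_nonneg (ρ := ρ) (c := gridCenter ρ k) ha x
      have h2 := (bump_le (c := gridCenter ρ k) ha hρ x).trans hb
      gcongr
    · rw [Set.indicator_of_notMem h, bump_eq_zero (not_lt.1 h)]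
      simp
  · by_cases h : ∃ k, x ∈ V k
    · obtain ⟨k, hk⟩ := h
      rw [Finset.sum_eq_single k]
      · rw [Set.indicator_of_mem hk]
      · intro l _ hl
        exact Set.indicator_of_notMem (fun hx ↦ Set.disjoint_left.1 (hdisj hl) hx hk) _
      · simp
    · push Not at h
      rw [Finset.sum_eq_zero fun k _ ↦ Set.indicator_of_notMem (h k) _]
      exact hK
  · have := isProbabilityMeasure_outputLaw A (ν := gaussianReal 0 v)
      (f := peak a s ρ (gridCenter ρ k)) measurable_peak
    have h := ENNReal.toReal_mono (measure_ne_top _ _)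
      ((hsucc k).trans (measure_mono fun x hx ↦ hS k x hx))
    rwa [ENNReal.toReal_div, ENNReal.toReal_ofNat, ENNReal.toReal_ofNat] at h

end LipschitzOpt

/-! ### Choice of scales and conclusion -/

theorem theorem4p4 (d : ℕ) (α : ℝ) (hα : 0 < α) (hαd : α ≤ d) (L : ℝ) (hL : 0 < L) :
    ∃ C c ε₀ : ℝ, 0 < C ∧ 0 < c ∧ 0 < ε₀ ∧
      ∀ σ : ℝ≥0, 0 < σ →
        -- Gaussian noise of variance `σ²` is an instance of `σ`-sub-Gaussian noise
        HasSubgaussianMGF id (σ ^ 2) (gaussianReal 0 (σ ^ 2)) ∧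
        ∀ ε : ℝ, 0 < ε → ε ≤ ε₀ →
          ∀ (T : ℕ) (A : LipschitzOpt.Algorithm d T),
            ∃ f : LipschitzOpt.cube d → ℝ,
              LipschitzOpt.IsLipschitzObjective L f ∧
              LipschitzOpt.MarginCondition C α f ∧
              ((2 / 3 : ℝ≥0∞) ≤ A.outputLaw (gaussianReal 0 (σ ^ 2)) f
                  {x | LipschitzOpt.regret f x ≤ ε} →
                c * (σ : ℝ) ^ 2 * ε ^ (-(2 + α)) ≤ (T : ℝ)) := by
  have hd : (0 : ℝ) < d := hα.trans_le hαd
  have hd0 : d ≠ 0 := by rintro rfl; simp at hd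
  obtain ⟨a, ha, haL, ha1⟩ : ∃ a : ℝ, 0 < a ∧ 2 * a ≤ L ∧ 2 * a ≤ 1 :=
    ⟨min L 1 / 2, by positivity, by linarith [min_le_left L 1], by linarith [min_le_right L 1]⟩
  -- The entry `a / 24` in `ε₀` forces `m ≥ 6`, and the entry 1 gives `s ≤ 1`. In `c`, `(a / 8) ^ d`
  -- comes from `m ≥ a * z / 8`, and 48 is `3 * 8`, doubled to absorb an additive 3.
  refine ⟨(2 / a) ^ d, (a / 8) ^ d / 48, min 1 ((a / 24) ^ ((d : ℝ) / α)), by positivity,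
    by positivity, by positivity, fun σ hσ ↦
    ⟨LipschitzOpt.hasSubgaussianMGF_id_gaussianReal _, fun ε hε hε₀ T A ↦ ?_⟩⟩
  have hε1 : ε ≤ 1 := hε₀.trans (min_le_left _ _)
  have hq : ε ^ (α / d) ≤ a / 24 := by
    have h := Real.rpow_le_rpow hε.le (hε₀.trans (min_le_right _ _)) (div_pos hα hd).le
    rwa [← Real.rpow_mul (by positivity), div_mul_div_cancel₀ hα.ne', div_self hd.ne',
      Real.rpow_one] at h
  set z : ℝ := ε ^ (-(α / d)) with hz
  have hz_mul : z * ε ^ (α / d) = 1 := by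
    rw [hz, ← Real.rpow_add hε]; simp
  have hz0 : 0 < z := Real.rpow_pos_of_pos hε _
  have hz6 : 6 ≤ a * z / 4 := by nlinarith
  -- Since `a * ρ = a * ε * z / (2 * m)`, keeping `m` between `a * z / 8` and `a * z / 4` puts the
  -- pyramid height between `2 * ε` and `4 * ε`.
  set m : ℕ := ⌊a * z / 4⌋₊
  have hm_le : (m : ℝ) ≤ a * z / 4 := Nat.floor_le (by positivity)
  have hm_lt : a * z / 4 < m + 1 := Nat.lt_floor_add_one _
  have hm6 : (6 : ℝ) ≤ m := by exact_mod_cast Nat.le_floor (by exact_mod_cast hz6)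
  have hm_ge : a * z / 8 ≤ m := by linarith
  have hm0 : (0 : ℝ) < m := by linarith
  set s : ℝ := ε * z with hs
  have hs_eq : s = ε ^ (((d : ℝ) - α) / d) := by
    rw [hs, hz, sub_div, div_self hd.ne', sub_eq_add_neg, Real.rpow_add hε, Real.rpow_one]
  have hs0 : 0 < s := by positivity
  have hexp : 0 ≤ ((d : ℝ) - α) / d := div_nonneg (sub_nonneg.2 hαd) hd.le
  have hs1 : s ≤ 1 := hs_eq ▸ Real.rpow_le_one hε.le hε1 hexp
  obtain ⟨ρ, hρ⟩ : ∃ ρ, ρ = s / (2 * m) := ⟨_, rfl⟩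
  have hρ0 : 0 < ρ := by rw [hρ]; positivity
  have hsρ : 2 * m * ρ = s := by rw [hρ]; field_simp
  have hρ1 : ρ ≤ 1 := by nlinarith
  have hlow : ε < a * ρ := by
    rw [hρ, hs, ← mul_div_assoc, lt_div_iff₀ (by positivity)]
    nlinarith [mul_pos hε (mul_pos ha hz0)]
  have hup : a * ρ ≤ 4 * ε := by
    rw [hρ, hs, ← mul_div_assoc, div_le_iff₀ (by positivity)]
    nlinarith
  have hmax (k : Fin d → Fin m) : LipschitzOpt.maxValue
      (LipschitzOpt.peak a s ρ (LipschitzOpt.gridCenter ρ k)) = a + a * ρ :=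
    LipschitzOpt.maxValue_peak ha.le hρ0.le hs0.le hs1
      fun i ↦ hsρ ▸ LipschitzOpt.gridCenter_mem hρ0.le k i
  have hobj (k : Fin d → Fin m) : LipschitzOpt.IsLipschitzObjective L
      (LipschitzOpt.peak a s ρ (LipschitzOpt.gridCenter ρ k)) :=
    LipschitzOpt.isLipschitzObjective_peak ha.le haL ha1 hs0.le hρ0.le hρ1
  have hmargin (k : Fin d → Fin m) : LipschitzOpt.MarginCondition ((2 / a) ^ d) α
      (LipschitzOpt.peak a s ρ (LipschitzOpt.gridCenter ρ k)) :=
    LipschitzOpt.marginCondition_peak hα hαd ha (by linarith) hρ0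
      (hs_eq ▸ Real.rpow_le_rpow hε.le hlow.le hexp) (hmax k)
  -- If no objective works, the algorithm succeeds on every peak while `T` is below the bound; the
  -- latter does not involve the cell, so any one cell supplies it.
  by_contra! hcon
  have hall (k : Fin d → Fin m) := hcon _ (hobj k) (hmargin k)
  have hv : σ ^ 2 ≠ 0 := by positivity
  have hcard := LipschitzOpt.card_grid_le A hv ha.le hρ0.le hup
    (fun k x hx ↦ LipschitzOpt.norm_sub_lt_of_regret_peak_le ha.le (hmax k) hlow hx)
    fun k ↦ (hall k).1
  have hT := (hall fun _ ↦ ⟨0, by exact_mod_cast hm0⟩).2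
  have hmd : (6 : ℝ) ≤ (m : ℝ) ^ d :=
    hm6.trans (le_self_pow₀ (by linarith) hd0)
  have hmd' : (a / 8) ^ d * ε ^ (-α) ≤ (m : ℝ) ^ d := by
    have hzd : z ^ d = ε ^ (-α) := by
      rw [hz, ← Real.rpow_natCast, ← Real.rpow_mul hε.le]
      congr 1; field_simp
    rw [← hzd, ← mul_pow]
    exact pow_le_pow_left₀ (by positivity) (by linarith) d
  have hεpow : ε ^ (-(2 + α)) * ε ^ 2 = ε ^ (-α) := by
    rw [← Real.rpow_natCast, ← Real.rpow_add hε]; congr 1; push_cast; ring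
  have hσ' : (0 : ℝ) < σ ^ 2 := by positivity
  push_cast at hcard
  -- From `m ^ d ≤ 3 + 24 * T * ε ^ 2 / σ ^ 2`, the 3 is at most half of `m ^ d` because `m ^ d ≥
  -- 6`.
  have h1 : (m : ℝ) ^ d * σ ^ 2 ≤ 48 * T * ε ^ 2 := by
    have h2 : (m : ℝ) ^ d ≤ 48 * T * ε ^ 2 / σ ^ 2 := by
      have : (T : ℝ) * ((4 * ε) ^ 2 / (2 * σ ^ 2)) = 8 * T * ε ^ 2 / σ ^ 2 := by
        field_simp; ring
      rw [this] at hcard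
      have h3 : 48 * T * ε ^ 2 / (σ : ℝ) ^ 2 = 6 * (8 * T * ε ^ 2 / σ ^ 2) := by ring
      linarith
    rwa [le_div_iff₀ hσ'] at h2
  have h4 := mul_le_mul_of_nonneg_right hmd' hσ'.le
  have h5 := mul_lt_mul_of_pos_right hT (pow_pos hε 2)
  rw [mul_assoc, hεpow] at h5
  linarith
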